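/- Let $\mathbb{H}^2$ be the hyperbolic plane in the upper half-plane model. Its ideal boundary is the unit circle $S^1$, via the Poincaré disk model, with its standard metric. For a discrete subgroup $\Gamma<\mathrm{Isom}(\mathbb{H}^2)$, the limit set $\Lambda(\Gamma)\subset S^1$ is the set of accumulation points on $S^1$ of the $\Gamma$-orbits in $\mathbb{H}^2$. The nonconical limit set $\Lambda_{nc}(\Gamma)$ is the set of those $\xi\in\Lambda(\Gamma)$ for which every (equivalently, some) geodesic ray $\mathbb{R}_+\to\mathbb{H}^2$ asymptotic to $\xi$ projects to a proper ray in $\mathbb{H}^2/\Gamma$, that is, one that eventually leaves every compact subset. **Theorem.** There is a discrete subgroup $\Gamma<\mathrm{Isom}(\mathbb{H}^2)$ that is not finitely generated and such that the Hausdorff dimension of its nonconical limit set is $$\dim\Lambda_{nc}(\Gamma)=0.$$ Explicitly, put $c_1=0$, $c_i=c_{i-1}+2^{i^2+2}+1$ for $i\ge 2$, and $r_i=2^{-2i^2}$ for $i\ge 1$. The closed Euclidean disks $\bar B(c_i,r_i)\subset\mathbb{C}$, $i\ge1$, are pairwise disjoint, and the subgroup $\Gamma$ generated by the inversions $h_i$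 in the semicircles $\partial B(c_i,r_i)\cap\mathbb{H}^2$, $i\ge1$, has these properties. -/

import Mathlib

open Filter Topology UpperHalfPlane

noncomputable section

/-! ## Isometries of the hyperbolic plane

`ℍ` is the upper half-plane with Mathlib's hyperbolic metric (curvature `-1`), and
`ℍ ≃ᵢ ℍ` is its full isometry group. -/

/-- The topology of the Lie group `Isom(ℍ²)`: the compact-open topology. -/
instance isomTopology : TopologicalSpace (ℍ ≃ᵢ ℍ) :=
  TopologicalSpace.induced (fun g => (⟨g, g.continuous⟩ : C(ℍ, ℍ))) inferInstance

/-- The tautological action of `Isom(ℍ²)` on `ℍ²`. -/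
instance isomAction : MulAction (ℍ ≃ᵢ ℍ) ℍ where
  smul g z := g z
  one_smul _ := rfl
  mul_smul _ _ _ := rfl

/-- The inversion in the Euclidean circle with center `c ∈ ℝ` and radius `r ≠ 0` preserves the
upper half-plane. -/
theorem inversion_im_pos (c : ℝ) {r : ℝ} (hr : r ≠ 0) (z : ℍ) :
    0 < (EuclideanGeometry.inversion (c : ℂ) r (z : ℂ)).im := by
  have hz : 0 < (z : ℂ).im := z.coe_im_pos
  have hne : (z : ℂ) ≠ (c : ℂ) := by
    intro h
    rw [h] at hz
    simp at hz
  have hd : 0 < dist (z : ℂ) (c : ℂ) := dist_pos.2 hne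
  have : (EuclideanGeometry.inversion (c : ℂ) r (z : ℂ)).im
      = (r / dist (z : ℂ) (c : ℂ)) ^ 2 * (z : ℂ).im := by
    simp [EuclideanGeometry.inversion, -Complex.ofReal_div, ← Complex.ofReal_pow]
  rw [this]
  positivity

/-- The inversion in the semicircle with center `c ∈ ℝ` and radius `r ≠ 0`, as a self-map of
the upper half-plane. -/
def inversionMap (c r : ℝ) (hr : r ≠ 0) (z : ℍ) : ℍ :=
  ⟨EuclideanGeometry.inversion (c : ℂ) r (z : ℂ), inversion_im_pos c hr z⟩

theorem inversionMap_involutive (c r : ℝ) (hr : r ≠ 0) :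
    Function.Involutive (inversionMap c r hr) := by
  intro z
  apply UpperHalfPlane.ext
  exact EuclideanGeometry.inversion_inversion (c : ℂ) hr (z : ℂ)

theorem inversionMap_isometry (c r : ℝ) (hr : r ≠ 0) : Isometry (inversionMap c r hr) := by
  have him : ∀ z : ℍ, (inversionMap c r hr z).im
      = (r / dist (z : ℂ) (c : ℂ)) ^ 2 * z.im := by
    intro z
    change (EuclideanGeometry.inversion (c : ℂ) r (z : ℂ)).im = _ * (z : ℂ).im
    simp [EuclideanGeometry.inversion, -Complex.ofReal_div, ← Complex.ofReal_pow]
  have hne : ∀ z : ℍ, (z : ℂ) ≠ (c : ℂ) := by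
    intro z h
    have hz : 0 < (z : ℂ).im := z.coe_im_pos
    rw [h] at hz
    simp at hz
  refine Isometry.of_dist_eq fun z w => ?_
  have hz := dist_pos.2 (hne z)
  have hw := dist_pos.2 (hne w)
  have h1 : dist ((inversionMap c r hr z : ℍ) : ℂ) (inversionMap c r hr w : ℍ)
      = r ^ 2 / (dist (z : ℂ) c * dist (w : ℂ) c) * dist (z : ℂ) w :=
    EuclideanGeometry.dist_inversion_inversion (hne z) (hne w) r
  have hk : 0 < r ^ 2 / (dist (z : ℂ) c * dist (w : ℂ) c) := by positivity
  rw [dist_eq, dist_eq, h1, him, him]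
  have h2 : (r / dist (z : ℂ) (c : ℂ)) ^ 2 * z.im * ((r / dist (w : ℂ) (c : ℂ)) ^ 2 * w.im)
      = (r ^ 2 / (dist (z : ℂ) c * dist (w : ℂ) c)) ^ 2 * (z.im * w.im) := by
    field_simp
  rw [h2, Real.sqrt_mul (sq_nonneg _), Real.sqrt_sq hk.le, mul_left_comm,
    mul_div_mul_left _ _ hk.ne']

/-- The inversion in the semicircle with center `c ∈ ℝ` and radius `r ≠ 0`, as an isometry of the
hyperbolic plane. -/
def inversionIsom (c r : ℝ) (hr : r ≠ 0) : ℍ ≃ᵢ ℍ where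
  toEquiv := (inversionMap_involutive c r hr).toPerm
  isometry_toFun := inversionMap_isometry c r hr

/-! ## Ideal boundary, limit set, nonconical limit set

The ideal boundary `∂ℍ²` is the unit circle of the Poincaré disk model, with its standard metric
(the chordal metric of `Circle`, bi-Lipschitz to the angular one). -/

/-- The Cayley transform, identifying the upper half-plane with the open unit disk in `ℂ`. -/
def toDisk (z : ℍ) : ℂ := ((z : ℂ) - Complex.I) / ((z : ℂ) + Complex.I)

/-- The limit set of `Γ`: all points of the ideal boundary at which some `Γ`-orbit in `ℍ²`
accumulates. -/
def limitSet (Γ : Subgroup (ℍ ≃ᵢ ℍ)) : Set Circle :=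
  {ξ | ∃ z : ℍ, AccPt (ξ : ℂ) (𝓟 (toDisk '' MulAction.orbit Γ z))}

/-- `ρ : [0, ∞) → ℍ²` is a (unit speed) geodesic ray asymptotic to the ideal point `ξ`. -/
structure IsGeodesicRayTo (ρ : NNReal → ℍ) (ξ : Circle) : Prop where
  isometry : Isometry ρ
  tendsto : Tendsto (fun t => toDisk (ρ t)) atTop (𝓝 (ξ : ℂ))

/-- The quotient `M = ℍ² / Γ`, with the quotient topology. -/
abbrev HypQuotient (Γ : Subgroup (ℍ ≃ᵢ ℍ)) : Type := MulAction.orbitRel.Quotient Γ ℍ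

/-- The projection `ℍ² → ℍ² / Γ`. -/
def hypProj (Γ : Subgroup (ℍ ≃ᵢ ℍ)) (z : ℍ) : HypQuotient Γ :=
  Quotient.mk (MulAction.orbitRel Γ ℍ) z

/-- The nonconical limit set of `Γ`: all limit points `ξ` such that every geodesic ray asymptotic
to `ξ` projects to a proper ray in `ℍ² / Γ`, i.e. one that eventually leaves every compact
subset. (Any two rays asymptotic to `ξ` stay at bounded distance, so "every" and "some" are
equivalent here.) -/
def nonconicalLimitSet (Γ : Subgroup (ℍ ≃ᵢ ℍ)) : Set Circle :=
  {ξ | ξ ∈ limitSet Γ ∧ ∀ ρ : NNReal → ℍ, IsGeodesicRayTo ρ ξ →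
    Tendsto (fun t => hypProj Γ (ρ t)) atTop (cocompact (HypQuotient Γ))}

/-! ## The centers and the radii (indexed by `i ≥ 1`; the value at `0` is not used) -/

/-- `c₁ = 0` and `cᵢ = cᵢ₋₁ + 2 ^ (i² + 2) + 1` for `i ≥ 2`. -/
def semicircleCenter : ℕ → ℝ
  | 0 => 0
  | 1 => 0
  | n + 2 => semicircleCenter (n + 1) + 2 ^ ((n + 2) ^ 2 + 2) + 1

/-- `rᵢ = 2 ^ (-2 i²)`. -/
def semicircleRadius (i : ℕ) : ℝ := (2 ^ (2 * i ^ 2))⁻¹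

theorem semicircleRadius_ne_zero (i : ℕ) : semicircleRadius i ≠ 0 := by
  unfold semicircleRadius
  positivity

end

noncomputable section

open EuclideanGeometry Metric
open scoped ENNReal NNReal MeasureTheory

/-! The inversions play ping-pong. Each sends the outside of its disk into the disk, so a nonempty
reduced word moves the common exterior into the disk of its leftmost letter (`dist_word_lt`). This
gives discreteness. It also rules out finite generation, since finitely many elements involve
finitely many letters.

For the dimension, invert a real point repeatedly, each time in the disk containing it. If it
reaches the exterior, it was not a limit point. If it hits a center or an endpoint, it belongs to a
countable set. Otherwise it has an infinite itinerary of disks. If indices below some `N` recur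
forever, translates of the vertical ray to the point keep crossing finitely many circles at heights
bounded below, so the ray returns to a compact set of the quotient and the point is conical
(`tendsto_of_mem_nonconicalLimitSet`).

Hence nonconical itineraries eventually avoid the first `N` disks, for every `N`. The points whose
itinerary always avoids them are covered by their own images under contractions of ratio at most `r
i`, `i ≥ N`. For large `N` the sum of the `r i ^ s` is below 1, so the dimension is at most `s`
(`exists_dimH_survivors_le`). Passing from "always" to "eventually" costs countably many Lipschitz
images, and `s` is arbitrary. -/

/-- Centers and radii of a sequence of small circles, centered on the real line, whose centers
are at mutual distance at least `2`. -/
structure SeparatedCircles (c r : ℕ → ℝ) : Prop where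
  pos : ∀ i, 0 < r i
  le : ∀ i, r i ≤ 1 / 4
  sep : ∀ i j, i ≠ j → 2 ≤ |c i - c j|

theorem im_inversion (c r : ℝ) (z : ℂ) :
    (inversion (c : ℂ) r z).im = (r / dist z c) ^ 2 * z.im := by
  simp only [inversion, Complex.real_smul, vsub_eq_sub, vadd_eq_add,
    Complex.add_im, Complex.ofReal_im, add_zero, Complex.im_ofReal_mul, Complex.sub_im, sub_zero]

theorem coe_ne_ofReal (z : ℍ) (x : ℝ) : (z : ℂ) ≠ x := by
  intro h
  have := z.coe_im_pos
  rw [h] at this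
  simp at this

/-! ### Ping-pong, discreteness and infinite generation -/

namespace SeparatedCircles

variable {c r : ℕ → ℝ} (h : SeparatedCircles c r)
include h

theorem two_le_dist_centers {i j : ℕ} (hij : i ≠ j) : 2 ≤ dist (c i : ℂ) (c j) := by
  rw [Complex.dist_eq, ← Complex.ofReal_sub, Complex.norm_real]
  exact h.sep i j hij

theorem one_le_dist {i j : ℕ} (hij : i ≠ j) {z : ℂ} (hz : dist z (c j) ≤ r j) :
    1 ≤ dist z (c i) := by
  have h1 := h.two_le_dist_centers hij
  have h2 := dist_triangle_left (c i : ℂ) (c j) z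
  have h3 := h.le j
  linarith

theorem dist_inversion_le {i : ℕ} {z : ℂ} (hz : 1 ≤ dist z (c i)) :
    dist (inversion (c i : ℂ) (r i) z) (c i) ≤ r i / 4 := by
  rw [dist_inversion_center, div_le_iff₀ (by linarith)]
  nlinarith [h.pos i, h.le i]

theorem inversion_mem_disk {i : ℕ} {z : ℂ} (hz : r i < dist z (c i)) :
    dist (inversion (c i : ℂ) (r i) z) (c i) < r i := by
  have := h.pos i
  rw [dist_inversion_center, div_lt_iff₀ (by linarith)]
  nlinarith

theorem lt_dist_inversion {i : ℕ} {z : ℂ} (hne : z ≠ c i) (hz : dist z (c i) < r i) :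
    r i < dist (inversion (c i : ℂ) (r i) z) (c i) := by
  have := dist_pos.2 hne
  have := h.pos i
  rw [dist_inversion_center, lt_div_iff₀ (by linarith)]
  nlinarith

theorem eq_of_dist_le {i j : ℕ} {z : ℂ} (hi : dist z (c i) ≤ r i) (hj : dist z (c j) ≤ r j) :
    i = j := by
  by_contra hij
  have := h.one_le_dist hij hj
  have := h.le i
  linarith

/-- The inversion in the `i`-th circle. -/
def gen (i : ℕ) : ℍ ≃ᵢ ℍ := inversionIsom (c i) (r i) (h.pos i).ne'

theorem gen_mul_self (i : ℕ) : h.gen i * h.gen i = 1 := by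
  ext1 z
  exact inversionMap_involutive (c i) (r i) (h.pos i).ne' z

theorem gen_inv (i : ℕ) : (h.gen i)⁻¹ = h.gen i := inv_eq_of_mul_eq_one_left (h.gen_mul_self i)

/-- The product of the inversions with indices in a list. -/
def word (w : List ℕ) : ℍ ≃ᵢ ℍ := (w.map h.gen).prod

theorem word_cons (i : ℕ) (w : List ℕ) : h.word (i :: w) = h.gen i * h.word w := by
  simp [word]

omit h in
/-- The points outside all closed disks. -/
def exterior (c r : ℕ → ℝ) : Set ℂ := {z | ∀ i, r i < dist z (c i)}

theorem mem_exterior_of_one_le_im {z : ℂ} (hz : 1 ≤ z.im) : z ∈ exterior c r := by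
  intro i
  have h1 := Complex.abs_im_le_norm (z - c i)
  have h2 := h.le i
  rw [Complex.sub_im, Complex.ofReal_im, sub_zero, abs_of_nonneg (by linarith)] at h1
  rw [Complex.dist_eq]
  linarith

/-- By induction the shorter word lands in a disk other than the `i`-th, hence outside the `i`-th,
and `gen i` brings it inside. -/
theorem dist_word_lt {z : ℍ} (hz : (z : ℂ) ∈ exterior c r) (i : ℕ) (w : List ℕ)
    (hw : (i :: w).IsChain (· ≠ ·)) : dist (h.word (i :: w) z : ℂ) (c i) < r i := by
  induction w generalizing i with
  | nil =>
    rw [word_cons]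
    exact h.inversion_mem_disk (hz i)
  | cons j w ih =>
    rw [List.isChain_cons_cons] at hw
    rw [word_cons]
    have h1 := h.one_le_dist hw.1 (ih j hw.2).le
    exact h.inversion_mem_disk (lt_of_lt_of_le (by linarith [h.le i]) h1)

/-- Multiplying a reduced word by a generator on the left either cancels its first letter or leaves
a longer reduced word. Neither brings in letters outside `S`. -/
theorem exists_word {S : Set ℕ} {g : ℍ ≃ᵢ ℍ} (hg : g ∈ Subgroup.closure (h.gen '' S)) :
    ∃ w : List ℕ, w.IsChain (· ≠ ·) ∧ (∀ i ∈ w, i ∈ S) ∧ h.word w = g := by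
  have key : ∀ i ∈ S, ∀ w : List ℕ, w.IsChain (· ≠ ·) → (∀ i ∈ w, i ∈ S) →
      ∃ w' : List ℕ, w'.IsChain (· ≠ ·) ∧ (∀ i ∈ w', i ∈ S) ∧
        h.word w' = h.gen i * h.word w := by
    intro i hi w hw hS
    by_cases hd : ∃ w', w = i :: w'
    · obtain ⟨w', rfl⟩ := hd
      refine ⟨w', hw.tail, fun j hj => hS j (List.mem_cons_of_mem _ hj), ?_⟩
      rw [word_cons, ← mul_assoc, gen_mul_self, one_mul]
    · refine ⟨i :: w, ?_, ?_, h.word_cons i w⟩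
      · cases w with
        | nil => simp
        | cons j w =>
          rw [List.isChain_cons_cons]
          refine ⟨?_, hw⟩
          rintro rfl
          exact hd ⟨w, rfl⟩
      · simpa [hi] using hS
  induction hg using Subgroup.closure_induction_left with
  | one => exact ⟨[], by simp, by simp, by simp [word]⟩
  | mul_left x hx y _ ih =>
    obtain ⟨i, hi, rfl⟩ := hx
    obtain ⟨w, hw, hS, rfl⟩ := ih
    exact key i hi w hw hS
  | inv_mul_cancel x hx y _ ih =>
    obtain ⟨i, hi, rfl⟩ := hx
    obtain ⟨w, hw, hS, rfl⟩ := ih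
    rw [gen_inv]
    exact key i hi w hw hS

/-- The group generated by the inversions. -/
def group : Subgroup (ℍ ≃ᵢ ℍ) := Subgroup.closure (Set.range h.gen)

theorem exists_word_of_mem_group {g : ℍ ≃ᵢ ℍ} (hg : g ∈ h.group) :
    ∃ w : List ℕ, w.IsChain (· ≠ ·) ∧ h.word w = g := by
  rw [group, ← Set.image_univ] at hg
  obtain ⟨w, hw, -, hg⟩ := h.exists_word hg
  exact ⟨w, hw, hg⟩

theorem gen_mem_group (i : ℕ) : h.gen i ∈ h.group :=
  Subgroup.subset_closure (Set.mem_range_self i)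

/-- Ping-pong: a nontrivial element moves the exterior of the disks off itself. -/
theorem eq_one_of_mem_exterior {g : ℍ ≃ᵢ ℍ} (hg : g ∈ h.group) {z : ℍ}
    (hz : (z : ℂ) ∈ exterior c r) (hgz : (g z : ℂ) ∈ exterior c r) : g = 1 := by
  obtain ⟨w, hw, rfl⟩ := h.exists_word_of_mem_group hg
  cases w with
  | nil => rfl
  | cons i w => exact absurd (h.dist_word_lt hz i w hw) (hgz i).not_gt

theorem I_mem_exterior : ((UpperHalfPlane.I : ℍ) : ℂ) ∈ exterior c r :=
  h.mem_exterior_of_one_le_im (by simp [UpperHalfPlane.I])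

/-- The disks are locally finite: a point within 3/4 of one center is more than 5/4 from all the
others, so only one disk limits the radius. -/
theorem exists_ball_subset_exterior {x : ℂ} (hx : x ∈ exterior c r) :
    ∃ ε > 0, ball x ε ⊆ exterior c r := by
  by_cases hd : ∃ i, dist x (c i) < 3 / 4
  · obtain ⟨i, hi⟩ := hd
    refine ⟨min (dist x (c i) - r i) (1 / 4), by have := hx i; simp [this], fun z hz j => ?_⟩
    rw [mem_ball, lt_min_iff] at hz
    by_cases hij : i = j
    · subst hij
      have := dist_triangle_left x (c i : ℂ) z
      linarith
    · have h1 := h.two_le_dist_centers hij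
      have h2 := dist_triangle_left (c i : ℂ) (c j) x
      have h3 := dist_triangle_left x (c j : ℂ) z
      have := h.le j
      linarith
  · push Not at hd
    refine ⟨1 / 4, by norm_num, fun z hz j => ?_⟩
    have h3 := dist_triangle_left x (c j : ℂ) z
    have := h.le j
    have := hd j
    rw [mem_ball] at hz
    linarith

theorem discreteTopology_group : DiscreteTopology h.group := by
  obtain ⟨ε, hε, hball⟩ := h.exists_ball_subset_exterior h.I_mem_exterior
  set U : Set ℍ := (fun z : ℍ => (z : ℂ)) ⁻¹' ball ((UpperHalfPlane.I : ℍ) : ℂ) ε with hUdef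
  have hU : IsOpen U := isOpen_ball.preimage UpperHalfPlane.continuous_coe
  have hev : Continuous fun g : ℍ ≃ᵢ ℍ => g UpperHalfPlane.I := by
    have h1 : Continuous fun g : ℍ ≃ᵢ ℍ => (⟨g, g.continuous⟩ : C(ℍ, ℍ)) :=
      continuous_induced_dom
    exact (continuous_eval_const (F := C(ℍ, ℍ)) UpperHalfPlane.I).comp h1
  refine discreteTopology_iff_isOpen_singleton.2 fun g => ?_
  -- By ping-pong, `g` is the only element of the group that sends `I` into `g U`.
  have hV : IsOpen ((fun g' : h.group => (g' : ℍ ≃ᵢ ℍ) UpperHalfPlane.I) ⁻¹'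
      ((g : ℍ ≃ᵢ ℍ).symm ⁻¹' U)) :=
    (hU.preimage (g : ℍ ≃ᵢ ℍ).symm.continuous).preimage (hev.comp continuous_subtype_val)
  convert hV
  ext g'
  simp only [Set.mem_singleton_iff, Set.mem_preimage]
  constructor
  · rintro rfl
    rw [IsometryEquiv.symm_apply_apply]
    exact mem_ball_self hε
  · intro hg'
    have h1 : (g : ℍ ≃ᵢ ℍ)⁻¹ * g' = 1 :=
      h.eq_one_of_mem_exterior (mul_mem (inv_mem g.2) g'.2) h.I_mem_exterior (hball hg')
    exact Subtype.ext (inv_mul_eq_one.1 h1).symm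

theorem not_fg_group : ¬ h.group.FG := by
  rintro ⟨T, hT⟩
  have hmono : Monotone fun n : ℕ => Subgroup.closure (h.gen '' Set.Iio n) := fun m n hmn =>
    Subgroup.closure_mono (Set.image_mono (Set.Iio_subset_Iio hmn))
  have hmem : ∀ g ∈ h.group, ∃ n, g ∈ Subgroup.closure (h.gen '' Set.Iio n) := by
    intro g hg
    obtain ⟨w, -, rfl⟩ := h.exists_word_of_mem_group hg
    induction w with
    | nil => exact ⟨0, one_mem _⟩
    | cons i w ih =>
      have hw : h.word w ∈ h.group := list_prod_mem (by simp [h.gen_mem_group])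
      obtain ⟨n, hn⟩ := ih hw
      refine ⟨max n (i + 1), ?_⟩
      rw [word_cons]
      refine mul_mem (Subgroup.subset_closure ⟨i, ?_, rfl⟩) (hmono (le_max_left _ _) hn)
      simp
  have hbound : ∃ n, (T : Set (ℍ ≃ᵢ ℍ)) ⊆ Subgroup.closure (h.gen '' Set.Iio n) := by
    have hTsub : ∀ g ∈ T, g ∈ h.group := fun g hg => hT ▸ Subgroup.subset_closure hg
    choose! n hn using fun g hg => hmem g (hTsub g hg)
    exact ⟨T.sup n, fun g hg => hmono (Finset.le_sup (Finset.mem_coe.1 hg)) (hn g hg)⟩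
  obtain ⟨n, hn⟩ := hbound
  have hgen : h.gen n ∈ Subgroup.closure (h.gen '' Set.Iio n) := by
    have := h.gen_mem_group n
    rw [← hT] at this
    exact (Subgroup.closure_le _).2 hn this
  -- `gen n` sends `I` into the `n`-th disk, whereas a word in the letters below `n` leaves `I`
  -- fixed or sends it into an earlier disk.
  obtain ⟨w, hw, hS, heq⟩ := h.exists_word hgen
  have h1 : dist (h.gen n UpperHalfPlane.I : ℂ) (c n) < r n := by
    have := h.dist_word_lt h.I_mem_exterior n [] (by simp)
    rwa [word_cons] at this
  rw [← heq] at h1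
  cases w with
  | nil => exact h1.not_gt (h.I_mem_exterior n)
  | cons i w =>
    have h2 := h.eq_of_dist_le (h.dist_word_lt h.I_mem_exterior i w hw).le h1.le
    have h3 := hS i (by simp)
    rw [h2] at h3
    simp at h3

end SeparatedCircles

/-! ### Hausdorff measure of self-similar sets -/

/-- A set with a cover of finite `s`-dimensional size, contained in the union of the images of its
pieces under a summable family of contractions, is null for the Hausdorff measure. -/
theorem hausdorffMeasure_eq_zero_of_subset_iUnion_image {X : Type*} [EMetricSpace X]
    [MeasurableSpace X] [BorelSpace X] {E : Set X} {f : ℕ → X → X} {D : ℕ → Set X} {K : ℕ → ℝ≥0}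
    {s : ℝ} (hs : 0 < s) (hf : ∀ i, LipschitzOnWith (K i) (f i) (D i))
    (hE : E ⊆ ⋃ i, f i '' (E ∩ D i)) (hK : ∀ i, (K i : ℝ≥0∞) ≤ 4⁻¹)
    (hsum : ∑' i, (K i : ℝ≥0∞) ^ s < 1) {t : ℕ → Set X} (ht : E ⊆ ⋃ i, t i)
    (hdiam : ∀ i, ediam (t i) ≤ 1) (hfin : ∑' i, ediam (t i) ^ s ≠ ⊤) :
    μH[s] E = 0 := by
  set θ := ∑' i, (K i : ℝ≥0∞) ^ s with hθ
  set C := ∑' i, ediam (t i) ^ s with hC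
  -- Pulling a cover through the family once divides the diameter bound by 4 and multiplies the
  -- `s`-size by at most `θ < 1`.
  have key : ∀ k : ℕ, ∃ u : ℕ → Set X, E ⊆ ⋃ i, u i ∧ (∀ i, ediam (u i) ≤ (4⁻¹ : ℝ≥0∞) ^ k) ∧
      ∑' i, ediam (u i) ^ s ≤ θ ^ k * C := by
    intro k
    induction k with
    | zero => exact ⟨t, ht, by simpa using hdiam, by simp [hC]⟩
    | succ k ih =>
      obtain ⟨u, hu, hud, hus⟩ := ih
      have hle : ∀ p : ℕ × ℕ, ediam (f p.1 '' (u p.2 ∩ D p.1)) ≤ K p.1 * ediam (u p.2) := by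
        intro p
        refine ediam_image_le_iff.2 fun x hx z hz => (hf p.1 hx.2 hz.2).trans ?_
        gcongr
        exact edist_le_ediam_of_mem hx.1 hz.1
      refine ⟨fun n => f n.unpair.1 '' (u n.unpair.2 ∩ D n.unpair.1), ?_, fun n => ?_, ?_⟩
      · intro x hx
        obtain ⟨i, y, ⟨hyE, hyD⟩, rfl⟩ := Set.mem_iUnion.1 (hE hx)
        obtain ⟨j, hj⟩ := Set.mem_iUnion.1 (hu hyE)
        refine Set.mem_iUnion.2 ⟨Nat.pair i j, ?_⟩
        simp only [Nat.unpair_pair]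
        exact ⟨y, ⟨hj, hyD⟩, rfl⟩
      · rw [pow_succ']
        exact (hle n.unpair).trans (mul_le_mul' (hK _) (hud _))
      · calc ∑' n : ℕ, ediam (f n.unpair.1 '' (u n.unpair.2 ∩ D n.unpair.1)) ^ s
            = ∑' p : ℕ × ℕ, ediam (f p.1 '' (u p.2 ∩ D p.1)) ^ s :=
              Nat.pairEquiv.symm.tsum_eq
                (fun p : ℕ × ℕ => ediam (f p.1 '' (u p.2 ∩ D p.1)) ^ s)
          _ ≤ ∑' p : ℕ × ℕ, (K p.1 : ℝ≥0∞) ^ s * ediam (u p.2) ^ s := by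
              refine ENNReal.tsum_le_tsum fun p => ?_
              rw [← ENNReal.mul_rpow_of_nonneg _ _ hs.le]
              exact ENNReal.rpow_le_rpow (hle p) hs.le
          _ = θ * ∑' j, ediam (u j) ^ s := by
              rw [ENNReal.tsum_prod (f := fun i j => (K i : ℝ≥0∞) ^ s * ediam (u j) ^ s)]
              simp_rw [ENNReal.tsum_mul_left]
              rw [ENNReal.tsum_mul_right]
          _ ≤ θ ^ (k + 1) * C := by
              rw [pow_succ', mul_assoc]
              gcongr
  choose u hu hud hus using key
  have h1 : μH[s] E ≤ liminf (fun k => ∑' i, ediam (u k i) ^ s) atTop :=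
    MeasureTheory.Measure.hausdorffMeasure_le_liminf_tsum s E (fun k => (4⁻¹ : ℝ≥0∞) ^ k)
      (ENNReal.tendsto_pow_atTop_nhds_zero_of_lt_one (by simp)) u
      (Eventually.of_forall hud) (Eventually.of_forall hu)
  have h2 : Tendsto (fun k => θ ^ k * C) atTop (𝓝 0) := by
    simpa using ENNReal.Tendsto.mul_const
      (ENNReal.tendsto_pow_atTop_nhds_zero_of_lt_one hsum) (Or.inr hfin)
  have h3 : liminf (fun k => ∑' i, ediam (u k i) ^ s) atTop ≤ liminf (fun k => θ ^ k * C) atTop :=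
    liminf_le_liminf (Eventually.of_forall hus)
  rw [h2.liminf_eq] at h3
  exact le_antisymm (h1.trans h3) zero_le

/-! ### Itineraries of real points and the dimension of the survivors -/

namespace SeparatedCircles

variable {c r : ℕ → ℝ}

/-- The points whose forward orbit under the inversions, each applied inside its own disk,
meets `P`. -/
inductive Reaches (c r : ℕ → ℝ) (P : Set ℂ) : ℂ → Prop
  | base {z : ℂ} (hz : z ∈ P) : Reaches c r P z
  | step {z : ℂ} (i : ℕ) (hne : z ≠ c i) (hlt : dist z (c i) < r i)
      (hr : Reaches c r P (inversion (c i : ℂ) (r i) z)) : Reaches c r P z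

theorem Reaches.mono {P Q : Set ℂ} (hPQ : P ⊆ Q) {z : ℂ} (hz : Reaches c r P z) :
    Reaches c r Q z := by
  induction hz with
  | base hz => exact .base (hPQ hz)
  | step i hne hlt _ ih => exact .step i hne hlt ih

/-- A sequence of points of the punctured disks, each being the image of the preceding one under
the inversion in the circle around it. -/
structure IsItinerary (c r : ℕ → ℝ) (y : ℕ → ℂ) (i : ℕ → ℕ) : Prop where
  ne : ∀ n, y n ≠ c (i n)
  lt : ∀ n, dist (y n) (c (i n)) < r (i n)
  succ : ∀ n, y (n + 1) = inversion (c (i n) : ℂ) (r (i n)) (y n)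

/-- The starting points of the itineraries that avoid the first `N` disks. -/
def survivors (c r : ℕ → ℝ) (N : ℕ) : Set ℂ :=
  {x | ∃ y i, IsItinerary c r y i ∧ y 0 = x ∧ ∀ n, N ≤ i n}

/-- Centers and real endpoints of the circles. -/
def markedPoints (c r : ℕ → ℝ) : Set ℂ :=
  ⋃ i, {(c i : ℂ), ((c i + r i : ℝ) : ℂ), ((c i - r i : ℝ) : ℂ)}

theorem countable_markedPoints : (markedPoints c r).Countable :=
  Set.countable_iUnion fun _ => Set.Finite.countable (by simp)

theorem IsItinerary.tail {y : ℕ → ℂ} {i : ℕ → ℕ} (hy : IsItinerary c r y i) (m : ℕ) :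
    IsItinerary c r (fun n => y (n + m)) (fun n => i (n + m)) where
  ne n := hy.ne _
  lt n := hy.lt _
  succ n := by
    rw [Nat.add_right_comm]
    exact hy.succ _

theorem IsItinerary.reaches {y : ℕ → ℂ} {i : ℕ → ℕ} (hy : IsItinerary c r y i) {P : Set ℂ} {m : ℕ}
    (hm : y m ∈ P) : Reaches c r P (y 0) := by
  induction m generalizing y i with
  | zero => exact .base hm
  | succ m ih =>
    refine .step (i 0) (hy.ne 0) (hy.lt 0) ?_
    rw [← hy.succ 0]
    exact ih (hy.tail 1) hm

theorem mem_markedPoints_of_dist_eq {x : ℂ} (hx : x.im = 0) {i : ℕ} (hi : dist x (c i) = r i) :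
    x ∈ markedPoints c r := by
  obtain ⟨x, rfl⟩ : ∃ t : ℝ, x = t := ⟨x.re, Complex.ext rfl (by simpa using hx)⟩
  rw [Complex.dist_eq, ← Complex.ofReal_sub, Complex.norm_real, Real.norm_eq_abs] at hi
  refine Set.mem_iUnion.2 ⟨i, ?_⟩
  rcases abs_choice (x - c i) with h | h
  · have : x = c i + r i := by linarith
    simp [this]
  · have : x = c i - r i := by linarith
    simp [this]

/-- A real point reaches the exterior or a marked point, or else it has an itinerary. -/
theorem reaches_or_exists_isItinerary {x : ℂ} (hx : x.im = 0) :
    Reaches c r (exterior c r) x ∨ Reaches c r (markedPoints c r) x ∨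
      ∃ y i, IsItinerary c r y i ∧ y 0 = x := by
  by_contra! hcon
  obtain ⟨h1, h2, h3⟩ := hcon
  -- Every point of `G` lies in a punctured open disk whose inversion keeps it in `G`, so iterating
  -- a choice of disk gives an itinerary.
  set G : Set ℂ := {x | x.im = 0 ∧ ¬ Reaches c r (exterior c r) x ∧
    ¬ Reaches c r (markedPoints c r) x} with hG
  have step : ∀ x ∈ G, ∃ i, x ≠ c i ∧ dist x (c i) < r i ∧ inversion (c i : ℂ) (r i) x ∈ G := by
    rintro x ⟨hx, he, hm⟩
    have hxe : x ∉ exterior c r := fun h => he (.base h)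
    have hxm : x ∉ markedPoints c r := fun h => hm (.base h)
    simp only [exterior, Set.mem_ofPred_eq, not_forall, not_lt] at hxe
    obtain ⟨i, hi⟩ := hxe
    have hne : x ≠ c i := by
      rintro rfl
      exact hxm (Set.mem_iUnion.2 ⟨i, by simp⟩)
    have hlt : dist x (c i) < r i :=
      lt_of_le_of_ne hi fun h => hxm (mem_markedPoints_of_dist_eq hx h)
    exact ⟨i, hne, hlt, by rw [im_inversion, hx, mul_zero], fun h => he (.step i hne hlt h),
      fun h => hm (.step i hne hlt h)⟩
  choose! ind hne hlt hG' using step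
  set y : ℕ → ℂ := fun n => (fun z => inversion (c (ind z) : ℂ) (r (ind z)) z)^[n] x with hy
  have hyG : ∀ n, y n ∈ G := by
    intro n
    induction n with
    | zero => exact ⟨hx, h1, h2⟩
    | succ n ih =>
      simp only [hy, Function.iterate_succ_apply']
      exact hG' _ ih
  refine h3 y (fun n => ind (y n)) ⟨fun n => hne _ (hyG n), fun n => hlt _ (hyG n), fun n => ?_⟩ rfl
  simp only [hy, Function.iterate_succ_apply']

variable (h : SeparatedCircles c r)
include h

omit h in
theorem lipschitzOnWith_inversion (r : ℕ → ℝ) (i : ℕ) {K : ℝ≥0} {δ : ℝ} (hδ : 0 < δ)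
    (hK : r i ^ 2 ≤ K * δ ^ 2) :
    LipschitzOnWith K (inversion (c i : ℂ) (r i)) {z | δ ≤ dist z (c i)} := by
  refine LipschitzOnWith.of_dist_le_mul fun z hz w hw => ?_
  have hz' : 0 < dist z (c i) := hδ.trans_le hz
  have hw' : 0 < dist w (c i) := hδ.trans_le hw
  rw [dist_inversion_inversion (dist_pos.1 hz') (dist_pos.1 hw')]
  refine mul_le_mul_of_nonneg_right ?_ dist_nonneg
  rw [div_le_iff₀ (by positivity)]
  refine hK.trans (mul_le_mul_of_nonneg_left ?_ K.2)
  rw [sq]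
  exact mul_le_mul hz hw hδ.le hz'.le

theorem dimH_reaches_le (P : Set ℂ) : dimH {z | Reaches c r P z} ≤ dimH P := by
  -- `A n` contains the points reaching `P` in `n` steps. Each step is undone by the same inversion,
  -- which is 1-Lipschitz outside its own disk.
  let A : ℕ → Set ℂ := fun n =>
    Nat.rec P (fun _ A => ⋃ i, inversion (c i : ℂ) (r i) '' (A ∩ {z | r i ≤ dist z (c i)})) n
  have hA : ∀ n, A (n + 1) =
      ⋃ i, inversion (c i : ℂ) (r i) '' (A n ∩ {z | r i ≤ dist z (c i)}) := fun _ => rfl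
  have hdim : ∀ n, dimH (A n) ≤ dimH P := by
    intro n
    induction n with
    | zero => exact le_rfl
    | succ n ih =>
      rw [hA, dimH_iUnion]
      refine iSup_le fun i => ?_
      refine (((lipschitzOnWith_inversion r i (K := 1) (h.pos i) (by simp)).mono
        Set.inter_subset_right).dimH_image_le).trans ?_
      exact (dimH_mono Set.inter_subset_left).trans ih
  have hsub : {z | Reaches c r P z} ⊆ ⋃ n, A n := by
    intro z hz
    induction hz with
    | base hz => exact Set.mem_iUnion.2 ⟨0, hz⟩
    | step i hne hlt _ ih =>
      obtain ⟨n, hn⟩ := Set.mem_iUnion.1 ih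
      refine Set.mem_iUnion.2 ⟨n + 1, ?_⟩
      rw [hA]
      exact Set.mem_iUnion.2 ⟨i, _, ⟨hn, (h.lt_dist_inversion hne hlt).le⟩,
        inversion_inversion _ (h.pos i).ne' _⟩
  refine (dimH_mono hsub).trans ?_
  rw [dimH_iUnion]
  exact iSup_le hdim

theorem itinerary_succ_ne {y : ℕ → ℂ} {i : ℕ → ℕ} (hy : IsItinerary c r y i) (n : ℕ) :
    i n ≠ i (n + 1) := by
  intro hn
  have h1 := h.lt_dist_inversion (hy.ne n) (hy.lt n)
  rw [← hy.succ, hn] at h1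
  exact h1.not_gt (hy.lt (n + 1))

theorem one_le_dist_itinerary_succ {y : ℕ → ℂ} {i : ℕ → ℕ} (hy : IsItinerary c r y i) (n : ℕ) :
    1 ≤ dist (y (n + 1)) (c (i n)) :=
  h.one_le_dist (h.itinerary_succ_ne hy n) (hy.lt (n + 1)).le

/-- The first point of an itinerary is the inversion of the second, which is again a survivor and
lies at distance at least 1 from the first center. -/
theorem survivors_subset (N : ℕ) : survivors c r N ⊆
    ⋃ k, inversion (c (k + N) : ℂ) (r (k + N)) ''
      (survivors c r N ∩ {z | 1 ≤ dist z (c (k + N))}) := by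
  rintro x ⟨y, i, hy, rfl, hN⟩
  obtain ⟨k, hk⟩ := Nat.exists_eq_add_of_le' (hN 0)
  refine Set.mem_iUnion.2 ⟨k, y 1, ⟨⟨_, _, hy.tail 1, rfl, fun n => hN _⟩, ?_⟩, ?_⟩
  · rw [Set.mem_ofPred_eq, ← hk]
    exact h.one_le_dist_itinerary_succ hy 0
  · rw [← hk, hy.succ 0, inversion_inversion _ (h.pos _).ne']

theorem exists_dimH_survivors_le {s : ℝ≥0} (hs : 0 < s)
    (hsum : Summable fun i => r i ^ (s : ℝ)) : ∃ N, dimH (survivors c r N) ≤ s := by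
  let K : ℕ → ℝ≥0 := fun i => ⟨r i, (h.pos i).le⟩
  have hKr : ∀ i, (K i : ℝ) = r i := fun _ => rfl
  have hs' : (0 : ℝ) < s := hs
  have hKsum : Summable fun i => K i ^ (s : ℝ) := by
    rw [← NNReal.summable_coe]
    simpa [hKr] using hsum
  have hfin : ∑' i, (K i : ℝ≥0∞) ^ (s : ℝ) ≠ ⊤ := by
    simp_rw [← ENNReal.coe_rpow_of_nonneg _ hs'.le]
    exact ENNReal.tsum_coe_ne_top_iff_summable.2 hKsum
  -- The ratio `r i` (instead of the sharper `r i ^ 2`) lets one tail sum control both the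
  -- contractions and the initial cover by disks.
  obtain ⟨N, hN⟩ := ((ENNReal.tendsto_sum_nat_add _ hfin).eventually_lt_const
    zero_lt_one).exists
  have hK4 : ∀ i, (K i : ℝ≥0∞) ≤ 4⁻¹ := by
    intro i
    have h1 : K i ≤ 4⁻¹ := by
      rw [← NNReal.coe_le_coe]
      rw [hKr]
      simpa using h.le i
    have h2 : ((4⁻¹ : ℝ≥0) : ℝ≥0∞) = 4⁻¹ := by
      rw [ENNReal.coe_inv (by norm_num)]
      simp
    rw [← h2]
    exact_mod_cast h1
  have hdiam : ∀ i, ediam (closedBall (c i : ℂ) (r i)) ≤ 2 * K i := by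
    intro i
    have := ediam_closedEBall_le (x := (c i : ℂ)) (r := (K i : ℝ≥0∞))
    rwa [Metric.closedEBall_coe] at this
  have hlip : ∀ k, LipschitzOnWith (K (k + N)) (inversion (c (k + N) : ℂ) (r (k + N)))
      {z | 1 ≤ dist z (c (k + N))} := by
    refine fun k => lipschitzOnWith_inversion r (k + N) one_pos ?_
    rw [hKr]
    nlinarith [h.le (k + N), h.pos (k + N)]
  have hcover : survivors c r N ⊆ ⋃ k, closedBall (c (k + N) : ℂ) (r (k + N)) := by
    rintro x ⟨y, i, hy, rfl, hi⟩
    obtain ⟨k, hk⟩ := Nat.exists_eq_add_of_le' (hi 0)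
    exact Set.mem_iUnion.2 ⟨k, by rw [← hk]; exact (hy.lt 0).le⟩
  have hone : ∀ k, ediam (closedBall (c (k + N) : ℂ) (r (k + N))) ≤ 1 := fun k =>
    calc ediam (closedBall (c (k + N) : ℂ) (r (k + N))) ≤ 2 * K (k + N) := hdiam _
      _ ≤ 4 * 4⁻¹ := mul_le_mul' (by norm_num) (hK4 _)
      _ = 1 := ENNReal.mul_inv_cancel (by simp) (by simp)
  have htsum : ∑' k, ediam (closedBall (c (k + N) : ℂ) (r (k + N))) ^ (s : ℝ) ≠ ⊤ := by
    refine ne_top_of_le_ne_top ?_ (ENNReal.tsum_le_tsum fun k =>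
      ENNReal.rpow_le_rpow (hdiam (k + N)) hs'.le)
    simp_rw [ENNReal.mul_rpow_of_nonneg _ _ hs'.le]
    rw [ENNReal.tsum_mul_left]
    exact ENNReal.mul_ne_top (by simp) hN.ne_top
  refine ⟨N, dimH_le_of_hausdorffMeasure_ne_top ?_⟩
  rw [hausdorffMeasure_eq_zero_of_subset_iUnion_image hs' hlip (h.survivors_subset N)
    (fun k => hK4 _) hN hcover hone htsum]
  simp

end SeparatedCircles

/-! ### Rays, accumulation points and the Cayley transform -/

theorem AccPt.image_of_forall_ne {X Y : Type*} [TopologicalSpace X] [TopologicalSpace Y]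
    {f : X → Y} {x : X} {A : Set X} (hx : AccPt x (𝓟 A)) (hf : ContinuousAt f x)
    (hne : ∀ a ∈ A, a ≠ x → f a ≠ f x) : AccPt (f x) (𝓟 (f '' A)) := by
  rw [accPt_iff_nhds] at hx ⊢
  intro U hU
  obtain ⟨a, ⟨haU, haA⟩, hax⟩ := hx _ (hf hU)
  exact ⟨f a, ⟨haU, a, haA, rfl⟩, hne a haA hax⟩

theorem not_tendsto_hypProj_cocompact {Γ : Subgroup (ℍ ≃ᵢ ℍ)} {ρ : ℝ≥0 → ℍ} {K : Set ℍ}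
    (hK : IsCompact K) (hρ : ∀ T, ∃ t ≥ T, ∃ g ∈ Γ, g (ρ t) ∈ K) :
    ¬ Tendsto (fun t => hypProj Γ (ρ t)) atTop (cocompact (HypQuotient Γ)) := by
  intro hlim
  have hcont : Continuous (hypProj Γ) := continuous_quotient_mk'
  obtain ⟨T, hT⟩ := (hlim.eventually (hK.image hcont).compl_mem_cocompact).exists_forall_of_atTop
  obtain ⟨t, ht, g, hg, hgK⟩ := hρ T
  refine hT t ht ⟨g (ρ t), hgK, ?_⟩
  exact Quotient.sound (s := MulAction.orbitRel Γ ℍ) ⟨⟨g, hg⟩, rfl⟩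

/-- The vertical geodesic of the upper half-plane that ends at `x`, parametrized by arc length. -/
def verticalLine (x t : ℝ) : ℍ := ⟨⟨x, Real.exp (-t)⟩, Real.exp_pos _⟩

theorem coe_verticalLine (x t : ℝ) : (verticalLine x t : ℂ) = ⟨x, Real.exp (-t)⟩ := rfl

theorem isometry_verticalLine (x : ℝ) : Isometry (verticalLine x) := by
  refine Isometry.of_dist_eq fun s t => ?_
  rw [UpperHalfPlane.dist_of_re_eq (z := verticalLine x s) (w := verticalLine x t) rfl]
  change dist (Real.log (Real.exp (-s))) (Real.log (Real.exp (-t))) = _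
  rw [Real.log_exp, Real.log_exp, dist_neg_neg]

theorem tendsto_coe_verticalLine (x : ℝ) :
    Tendsto (fun t => (verticalLine x t : ℂ)) atTop (𝓝 (x : ℂ)) := by
  have h1 : Tendsto (fun t : ℝ => (x : ℂ) + (Real.exp (-t) : ℝ) * Complex.I) atTop
      (𝓝 ((x : ℂ) + ((0 : ℝ) : ℂ) * Complex.I)) :=
    (((Complex.continuous_ofReal.tendsto 0).comp
      (Real.tendsto_exp_atBot.comp tendsto_neg_atTop_atBot)).mul_const _).const_add _
  simp only [Complex.ofReal_zero, zero_mul, add_zero] at h1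
  refine h1.congr fun t => ?_
  rw [coe_verticalLine, Complex.mk_eq_add_mul_I]

/-- The Cayley transform on `ℂ`. -/
def cayley (z : ℂ) : ℂ := (z - Complex.I) / (z + Complex.I)

theorem add_I_ne_zero {z : ℂ} (hz : 0 ≤ z.im) : z + Complex.I ≠ 0 := by
  intro h0
  have := congrArg Complex.im h0
  simp at this
  linarith

theorem continuousAt_cayley {z : ℂ} (hz : 0 ≤ z.im) : ContinuousAt cayley z :=
  (continuousAt_id.sub continuousAt_const).div (continuousAt_id.add continuousAt_const)
    (add_I_ne_zero hz)

theorem isGeodesicRayTo_verticalLine {x : ℝ} {ξ : Circle} (hξ : (ξ : ℂ) = cayley x) :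
    IsGeodesicRayTo (fun t : ℝ≥0 => verticalLine x t) ξ where
  isometry := (isometry_verticalLine x).comp isometry_subtype_coe
  tendsto := by
    rw [hξ]
    exact ((continuousAt_cayley (by simp)).tendsto.comp (tendsto_coe_verticalLine x)).comp
      (NNReal.tendsto_coe_atTop.2 tendsto_id)

/-- The inverse of the Cayley transform. -/
def cayleyInv (w : ℂ) : ℂ := Complex.I * (1 + w) / (1 - w)

theorem cayleyInv_cayley {z : ℂ} (hz : z + Complex.I ≠ 0) : cayleyInv (cayley z) = z := by
  have h1 : 1 + cayley z = 2 * z / (z + Complex.I) := by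
    rw [cayley]; field_simp; ring
  have h2 : 1 - cayley z = 2 * Complex.I / (z + Complex.I) := by
    rw [cayley]; field_simp; ring
  rw [cayleyInv, h1, h2]
  have := Complex.I_ne_zero
  field_simp

theorem cayley_cayleyInv {w : ℂ} (hw : w ≠ 1) : cayley (cayleyInv w) = w := by
  have hw' : 1 - w ≠ 0 := sub_ne_zero.2 hw.symm
  have h1 : cayleyInv w - Complex.I = 2 * Complex.I * w / (1 - w) := by
    rw [cayleyInv]; field_simp; ring
  have h2 : cayleyInv w + Complex.I = 2 * Complex.I / (1 - w) := by
    rw [cayleyInv]; field_simp; ring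
  rw [cayley, h1, h2]
  have := Complex.I_ne_zero
  field_simp

theorem im_cayleyInv_circle (ξ : Circle) : (cayleyInv ξ).im = 0 := by
  have hn : (starRingEnd ℂ) (ξ : ℂ) = (ξ : ℂ)⁻¹ := by
    rw [← Circle.coe_inv_eq_conj, Circle.coe_inv]
  rw [← Complex.conj_eq_iff_im, cayleyInv]
  have h0 : (ξ : ℂ) ≠ 0 := Circle.coe_ne_zero ξ
  -- The point 1 corresponds to ∞; there the denominator vanishes and `cayleyInv` takes the value 0.
  by_cases h1 : (ξ : ℂ) = 1
  · simp [h1]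
  have h2 : 1 - (ξ : ℂ) ≠ 0 := sub_ne_zero.2 (Ne.symm h1)
  have h3 : 1 - (ξ : ℂ)⁻¹ ≠ 0 := by
    rw [sub_ne_zero]
    intro h
    exact h1 (by rw [← inv_inv (ξ : ℂ), ← h, inv_one])
  simp only [map_div₀, map_mul, map_add, map_sub, map_one, Complex.conj_I, hn]
  rw [div_eq_div_iff h3 h2]
  field_simp
  ring

theorem accPt_cayleyInv {Γ : Subgroup (ℍ ≃ᵢ ℍ)} {z : ℍ} {ξ : Circle} (hξ : (ξ : ℂ) ≠ 1)
    (hacc : AccPt (ξ : ℂ) (𝓟 (toDisk '' MulAction.orbit Γ z))) :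
    AccPt (cayleyInv ξ) (𝓟 ((fun p : ℍ => (p : ℂ)) '' MulAction.orbit Γ z)) := by
  have hinv : ∀ p : ℍ, cayleyInv (toDisk p) = p := fun p =>
    cayleyInv_cayley (add_I_ne_zero p.coe_im_pos.le)
  have hcont : ContinuousAt cayleyInv (ξ : ℂ) :=
    (continuousAt_const.mul (continuousAt_const.add continuousAt_id)).div
      (continuousAt_const.sub continuousAt_id) (sub_ne_zero.2 hξ.symm)
  have := hacc.image_of_forall_ne hcont ?_
  · rw [Set.image_image] at this
    simpa only [hinv] using this
  · rintro _ ⟨p, -, rfl⟩ - heq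
    have h1 := p.coe_im_pos
    rw [← hinv p, heq, im_cayleyInv_circle] at h1
    exact h1.false

theorem lipschitzOnWith_cayley : LipschitzOnWith 2 cayley {z | 0 ≤ z.im} := by
  have hI : ∀ z : ℂ, 0 ≤ z.im → 1 ≤ ‖z + Complex.I‖ := by
    intro z hz
    refine le_trans ?_ (Complex.abs_im_le_norm _)
    rw [Complex.add_im, Complex.I_im, abs_of_nonneg] <;> linarith
  refine LipschitzOnWith.of_dist_le_mul fun z hz w hw => ?_
  have h1 : cayley z - cayley w =
      2 * Complex.I * (z - w) / ((z + Complex.I) * (w + Complex.I)) := by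
    have := add_I_ne_zero hz
    have := add_I_ne_zero hw
    rw [cayley, cayley]
    field_simp
    ring
  have h2 := hI z hz
  have h3 := hI w hw
  rw [Complex.dist_eq, h1, norm_div, norm_mul, norm_mul, norm_mul, Complex.norm_I, Complex.dist_eq,
    div_le_iff₀ (by positivity)]
  simp only [RCLike.norm_ofNat, mul_one, NNReal.coe_ofNat]
  exact le_mul_of_one_le_right (by positivity) (one_le_mul_of_one_le_of_one_le h2 h3)

/-! ### Itineraries of nonconical limit points -/

namespace SeparatedCircles

variable {c r : ℕ → ℝ}

theorem isCompact_arc (a ρ : ℝ) {η : ℝ} (hη : 0 < η) :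
    IsCompact {q : ℍ | dist (q : ℂ) a = ρ ∧ η ≤ q.im} := by
  rw [UpperHalfPlane.isEmbedding_coe.isCompact_iff]
  have : (fun p : ℍ => (p : ℂ)) '' {q : ℍ | dist (q : ℂ) a = ρ ∧ η ≤ q.im} =
      sphere (a : ℂ) ρ ∩ {z | η ≤ z.im} := by
    ext z
    constructor
    · rintro ⟨q, hq, rfl⟩
      exact hq
    · intro hz
      exact ⟨⟨z, hη.trans_le hz.2⟩, hz, rfl⟩
  rw [this]
  exact (isCompact_sphere _ _).inter_right (isClosed_le continuous_const Complex.continuous_im)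

variable (h : SeparatedCircles c r)
include h

/-- Accumulation would put two distinct points of one orbit in a ball inside the exterior, against
ping-pong. -/
theorem not_accPt_of_mem_exterior {x : ℂ} (hx : x ∈ exterior c r) (z : ℍ) :
    ¬ AccPt x (𝓟 ((fun p : ℍ => (p : ℂ)) '' MulAction.orbit h.group z)) := by
  intro hacc
  obtain ⟨ε, hε, hball⟩ := h.exists_ball_subset_exterior hx
  rw [accPt_iff_nhds] at hacc
  obtain ⟨_, ⟨hpx, p, ⟨g, rfl⟩, rfl⟩, hne⟩ := hacc _ (ball_mem_nhds x hε)
  obtain ⟨_, ⟨hqx, q, ⟨g', rfl⟩, rfl⟩, -⟩ := hacc _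
    (inter_mem (ball_mem_nhds x hε) (isOpen_ne.mem_nhds hne.symm))
  refine hqx.2 ?_
  have h1 : (g' * g⁻¹ : ℍ ≃ᵢ ℍ) = 1 := by
    refine h.eq_one_of_mem_exterior (mul_mem g'.2 (inv_mem g.2)) (hball hpx) (hball ?_)
    convert hqx.1 using 3
    change g'.1 (g.1.symm (g.1 z)) = _
    rw [IsometryEquiv.symm_apply_apply]
    rfl
  have h2 : g' = g := Subtype.ext (mul_inv_eq_one.1 h1)
  rw [h2]

theorem accPt_inversion {x : ℂ} {i : ℕ} (hne : x ≠ c i) {z : ℍ}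
    (hacc : AccPt x (𝓟 ((fun p : ℍ => (p : ℂ)) '' MulAction.orbit h.group z))) :
    AccPt (inversion (c i : ℂ) (r i) x)
      (𝓟 ((fun p : ℍ => (p : ℂ)) '' MulAction.orbit h.group z)) := by
  have h1 := hacc.image_of_forall_ne
    (ContinuousAt.inversion continuousAt_const continuousAt_const continuousAt_id hne)
    fun a _ hax heq => hax (inversion_injective _ (h.pos i).ne' heq)
  refine h1.mono (principal_mono.2 ?_)
  rintro _ ⟨_, ⟨p, ⟨g, rfl⟩, rfl⟩, rfl⟩
  exact ⟨h.gen i (g.1 z), ⟨⟨h.gen i * g, mul_mem (h.gen_mem_group i) g.2⟩, rfl⟩, rfl⟩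

theorem not_accPt_of_reaches_exterior {x : ℂ} (hx : Reaches c r (exterior c r) x) (z : ℍ) :
    ¬ AccPt x (𝓟 ((fun p : ℍ => (p : ℂ)) '' MulAction.orbit h.group z)) := by
  induction hx with
  | base hz => exact h.not_accPt_of_mem_exterior hz z
  | step i hne _ _ ih => exact fun hacc => ih (h.accPt_inversion hne hacc)

/-- Apply successively the inversions with indices `i 0`, `i 1`, …, `i (n - 1)`. -/
def descend (i : ℕ → ℕ) : ℕ → ℍ → ℍ
  | 0, z => z
  | n + 1, z => h.gen (i n) (descend i n z)

theorem coe_descend_succ (i : ℕ → ℕ) (n : ℕ) (z : ℍ) : (h.descend i (n + 1) z : ℂ) =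
    inversion (c (i n) : ℂ) (r (i n)) (h.descend i n z) := rfl

theorem exists_mem_group_descend (i : ℕ → ℕ) (n : ℕ) (z : ℍ) :
    ∃ g ∈ h.group, g z = h.descend i n z := by
  induction n with
  | zero => exact ⟨1, one_mem _, rfl⟩
  | succ n ih =>
    obtain ⟨g, hg, hgz⟩ := ih
    refine ⟨h.gen (i n) * g, mul_mem (h.gen_mem_group _) hg, ?_⟩
    rw [descend, ← hgz]
    rfl

theorem continuous_descend (i : ℕ → ℕ) (n : ℕ) : Continuous (h.descend i n) := by
  induction n with
  | zero => exact continuous_id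
  | succ n ih => exact (h.gen (i n)).continuous.comp ih

theorem tendsto_descend {y : ℕ → ℂ} {i : ℕ → ℕ} (hy : IsItinerary c r y i) {α : Type*}
    {l : Filter α} {z : α → ℍ} (hz : Tendsto (fun t => (z t : ℂ)) l (𝓝 (y 0))) (n : ℕ) :
    Tendsto (fun t => (h.descend i n (z t) : ℂ)) l (𝓝 (y n)) := by
  induction n with
  | zero => exact hz
  | succ n ih =>
    rw [hy.succ]
    exact tendsto_const_nhds.inversion tendsto_const_nhds ih (hy.ne n)

theorem lt_dist_descend {y : ℕ → ℂ} {i : ℕ → ℕ} (hy : IsItinerary c r y i) {z : ℍ}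
    (hz : (z : ℂ) ∈ exterior c r) (n : ℕ) : r (i n) < dist (h.descend i n z : ℂ) (c (i n)) := by
  induction n with
  | zero => exact hz _
  | succ n ih =>
    have h1 := h.inversion_mem_disk ih
    rw [← coe_descend_succ] at h1
    have h2 := h.one_le_dist (h.itinerary_succ_ne hy n).symm h1.le
    linarith [h.le (i (n + 1))]

/-- The images of the vertical geodesic ending at the start of an itinerary are geodesics, whose
second endpoint lies in the last disk. -/
theorem exists_endpoint {y : ℕ → ℂ} {i : ℕ → ℕ} (hy : IsItinerary c r y i) (n : ℕ) :
    ∃ b : ℂ, dist b (c (i n)) ≤ r (i n) ∧ ∀ z : ℍ, dist (z : ℂ) (y 0) = z.im →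
      dist (h.descend i (n + 1) z : ℂ) (y (n + 1)) * dist (h.descend i (n + 1) z : ℂ) b =
        (h.descend i (n + 1) z).im * dist (y (n + 1)) b := by
  induction n with
  | zero =>
    -- For real `a`, `b`, the identity `|q - a| |q - b| = im q |a - b|` computes twice the area of
    -- the right triangle `a q b`, so it describes the geodesic from `a` to `b`. The vertical line
    -- has second endpoint ∞, which the first inversion sends to the center.
    refine ⟨c (i 0), by simpa using (h.pos _).le, fun z hz => ?_⟩
    have h1 := dist_pos.2 (hy.ne 0)
    have h2 := dist_pos.2 (coe_ne_ofReal z (c (i 0)))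
    rw [← coe_im, coe_descend_succ, im_inversion, hy.succ, dist_inversion_center,
      dist_inversion_center, dist_inversion_inversion (coe_ne_ofReal _ _) (hy.ne 0)]
    change _ / (dist (z : ℂ) _ * _) * dist (z : ℂ) _ * (_ / dist (z : ℂ) _) =
      (_ / dist (z : ℂ) _) ^ 2 * z.im * _
    rw [hz]
    field_simp
  | succ n ih =>
    obtain ⟨b, hb, hbz⟩ := ih
    have hb1 := h.one_le_dist (h.itinerary_succ_ne hy n).symm hb
    have hbne : b ≠ c (i (n + 1)) := dist_pos.1 (by linarith)
    refine ⟨inversion (c (i (n + 1)) : ℂ) (r (i (n + 1))) b, ?_, fun z hz => ?_⟩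
    · have := h.dist_inversion_le hb1
      linarith [h.pos (i (n + 1))]
    · have h0 := hbz z hz
      have h1 := dist_pos.2 (hy.ne (n + 1))
      have h2 := dist_pos.2 (coe_ne_ofReal (h.descend i (n + 1) z) (c (i (n + 1))))
      have h3 := dist_pos.2 hbne
      rw [← coe_im, coe_descend_succ, im_inversion, hy.succ (n + 1),
        dist_inversion_inversion (coe_ne_ofReal _ _) (hy.ne _),
        dist_inversion_inversion (coe_ne_ofReal _ _) hbne,
        dist_inversion_inversion (hy.ne _) hbne, coe_im]
      field_simp
      linear_combination r (i (n + 1)) ^ 4 * h0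

/-- Going back one step inverts a point at distance at least 1 from the center, which divides its
height by at least 4 and lands in the preceding disk. Deep crossings therefore occur late on the
ray. -/
theorem im_le_of_descend {y : ℕ → ℂ} {i : ℕ → ℕ} (hy : IsItinerary c r y i) {z : ℍ} {n : ℕ}
    (hn : dist (h.descend i n z : ℂ) (c (i n)) ≤ r (i n)) :
    z.im ≤ (1 / 4) ^ n * (h.descend i n z).im := by
  induction n with
  | zero => simp [descend]
  | succ n ih =>
    have h1 := h.one_le_dist (h.itinerary_succ_ne hy n) hn
    have h2 : (h.descend i n z : ℂ) =
        inversion (c (i n) : ℂ) (r (i n)) (h.descend i (n + 1) z) := by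
      rw [coe_descend_succ, inversion_inversion _ (h.pos _).ne']
    have h3 := h.dist_inversion_le h1
    rw [← h2] at h3
    refine (ih (by linarith [h.pos (i n)])).trans ?_
    rw [pow_succ, mul_assoc]
    refine mul_le_mul_of_nonneg_left ?_ (by positivity)
    rw [← coe_im, h2, im_inversion, coe_im]
    refine mul_le_mul_of_nonneg_right ?_ (h.descend i (n + 1) z).im_pos.le
    have h4 : r (i n) / dist (h.descend i (n + 1) z : ℂ) (c (i n)) ≤ 1 / 4 := by
      rw [div_le_iff₀ (by linarith)]
      linarith [h.le (i n)]
    have h5 : 0 ≤ r (i n) / dist (h.descend i (n + 1) z : ℂ) (c (i n)) :=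
      div_nonneg (h.pos _).le dist_nonneg
    nlinarith

/-- Intermediate values: the image of the ray starts outside the `n`-th disk of the itinerary and
converges to `y n` inside it. -/
theorem exists_crossing {y : ℕ → ℂ} {i : ℕ → ℕ} (hy : IsItinerary c r y i) {x : ℝ}
    (hx : y 0 = x) (n : ℕ) :
    ∃ t : ℝ, 0 ≤ t ∧ dist (h.descend i n (verticalLine x t) : ℂ) (c (i n)) = r (i n) := by
  set F : ℝ → ℝ := fun t => dist (h.descend i n (verticalLine x t) : ℂ) (c (i n)) with hF
  have hcont : Continuous F := (UpperHalfPlane.continuous_coe.comp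
    ((h.continuous_descend i n).comp (isometry_verticalLine x).continuous)).dist continuous_const
  have h0 : r (i n) < F 0 :=
    h.lt_dist_descend hy (h.mem_exterior_of_one_le_im (by simp [coe_verticalLine])) n
  have hlim : Tendsto F atTop (𝓝 (dist (y n) (c (i n)))) :=
    (h.tendsto_descend hy (hx ▸ tendsto_coe_verticalLine x) n).dist tendsto_const_nhds
  obtain ⟨T, hT, hT0⟩ := ((hlim.eventually_lt_const (hy.lt n)).and (eventually_ge_atTop 0)).exists
  obtain ⟨t, ht, hFt⟩ := intermediate_value_Icc' hT0 hcont.continuousOn ⟨hT.le, h0.le⟩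
  exact ⟨t, ht.1, hFt⟩

/-- The crossing point `q` is on the circle, the endpoint `a` is within `r / 4` of its center, and
the other endpoint `b` is at distance at least 1 from that center. So `|q - a| ≥ 3r/4` and `|a - b|
≤ 2 |q - b|`, and the geodesic identity gives height at least `3r/8`. -/
theorem le_im_of_crossing {y : ℕ → ℂ} {i : ℕ → ℕ} (hy : IsItinerary c r y i) {z : ℍ} {n : ℕ}
    (hz : dist (z : ℂ) (y 0) = z.im)
    (hn : dist (h.descend i (n + 1) z : ℂ) (c (i (n + 1))) = r (i (n + 1))) :
    3 / 8 * r (i (n + 1)) ≤ (h.descend i (n + 1) z).im := by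
  obtain ⟨b, hb, hbz⟩ := h.exists_endpoint hy n
  have h0 := hbz z hz
  have hb1 := h.one_le_dist (h.itinerary_succ_ne hy n).symm hb
  have hy1 : dist (y (n + 1)) (c (i (n + 1))) ≤ r (i (n + 1)) / 4 := by
    have := h.dist_inversion_le (h.one_le_dist_itinerary_succ hy (n + 1))
    rwa [hy.succ (n + 1), inversion_inversion _ (h.pos _).ne'] at this
  have hpos := h.pos (i (n + 1))
  have hle := h.le (i (n + 1))
  have him := (h.descend i (n + 1) z).im_pos
  set q : ℂ := (h.descend i (n + 1) z : ℂ)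
  set a := y (n + 1)
  set C : ℂ := (c (i (n + 1)) : ℂ)
  have t1 := dist_triangle_left q C a
  have t2 := dist_triangle_left b C q
  have t3 := dist_triangle a C b
  have t4 := dist_triangle_right a b q
  have e1 : dist a q = dist q a := dist_comm _ _
  have e2 : dist b q = dist q b := dist_comm _ _
  have e3 : dist C b = dist b C := dist_comm _ _
  have e4 : dist q C ≤ dist q a + dist a C := dist_triangle _ _ _
  have e5 : dist a b ≤ dist a C + dist C q + dist q b :=
    (dist_triangle a q b).trans (by linarith [dist_triangle a C q])
  have e6 : dist C q = dist q C := dist_comm _ _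
  have k1 : 3 / 4 * r (i (n + 1)) ≤ dist q a := by linarith
  have k2 : 3 / 4 ≤ dist q b := by linarith
  have k3 : dist a b ≤ 2 * dist q b := by linarith
  have k4 : 3 / 4 * r (i (n + 1)) * dist q b ≤ (h.descend i (n + 1) z).im * (2 * dist q b) := by
    calc _ ≤ dist q a * dist q b := mul_le_mul_of_nonneg_right k1 dist_nonneg
      _ = _ := h0
      _ ≤ _ := mul_le_mul_of_nonneg_left k3 him.le
  have k5 : 0 < dist q b := by linarith
  nlinarith

/-- The indices of an itinerary that starts at a nonconical limit point tend to infinity. -/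
theorem tendsto_of_mem_nonconicalLimitSet {y : ℕ → ℂ} {i : ℕ → ℕ} (hy : IsItinerary c r y i)
    {x : ℝ} (hx : y 0 = x) {ξ : Circle} (hξ : (ξ : ℂ) = cayley x)
    (hmem : ξ ∈ nonconicalLimitSet h.group) : Tendsto i atTop atTop := by
  by_contra hcon
  rw [Filter.tendsto_atTop] at hcon
  push Not at hcon
  obtain ⟨N, hN⟩ := hcon
  have hK : IsCompact (⋃ j ∈ Set.Iio N,
      {q : ℍ | dist (q : ℂ) (c j) = r j ∧ 3 / 8 * r j ≤ q.im}) :=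
    (Set.finite_Iio N).isCompact_biUnion fun j _ =>
      isCompact_arc _ _ (by linarith [h.pos j])
  refine not_tendsto_hypProj_cocompact hK ?_ (hmem.2 _ (isGeodesicRayTo_verticalLine hξ))
  intro T
  -- A crossing after more than `m` inversions has `exp (-t) ≤ (1/4) ^ m < exp (-T)`, hence `t ≥ T`.
  obtain ⟨m, hm⟩ := exists_pow_lt_of_lt_one (Real.exp_pos (-T)) (by norm_num : (1 / 4 : ℝ) < 1)
  obtain ⟨k, hk, hiN⟩ := frequently_atTop.1 hN (m + 1)
  obtain ⟨n, rfl⟩ := Nat.exists_eq_add_of_le' (show 1 ≤ k by omega)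
  obtain ⟨t, ht, hcross⟩ := h.exists_crossing hy hx (n + 1)
  have hvert : dist (verticalLine x t : ℂ) (y 0) = (verticalLine x t).im := by
    rw [hx, coe_verticalLine, Complex.dist_of_re_eq (by simp)]
    simp only [Complex.ofReal_im, Real.dist_eq, sub_zero]
    exact abs_of_pos (Real.exp_pos _)
  have hT : (T : ℝ) ≤ t := by
    have h1 := h.im_le_of_descend hy hcross.le
    have h2 : (h.descend i (n + 1) (verticalLine x t)).im ≤ 1 := by
      have := Complex.abs_im_le_norm
        ((h.descend i (n + 1) (verticalLine x t) : ℂ) - c (i (n + 1)))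
      rw [← Complex.dist_eq, hcross, Complex.sub_im, Complex.ofReal_im, sub_zero] at this
      linarith [le_abs_self (h.descend i (n + 1) (verticalLine x t) : ℂ).im,
        h.le (i (n + 1)), coe_im (h.descend i (n + 1) (verticalLine x t))]
    have h3 : Real.exp (-t) ≤ (1 / 4) ^ (n + 1) :=
      h1.trans (mul_le_of_le_one_right (by positivity) h2)
    have h4 : ((1 : ℝ) / 4) ^ (n + 1) ≤ (1 / 4) ^ m :=
      pow_le_pow_of_le_one (by norm_num) (by norm_num) (by omega)
    have h5 := Real.exp_le_exp.1 (h3.trans (h4.trans hm.le))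
    linarith
  obtain ⟨g, hg, hgz⟩ := h.exists_mem_group_descend i (n + 1) (verticalLine x t)
  refine ⟨⟨t, ht⟩, hT, g, hg, ?_⟩
  change g (verticalLine x t) ∈ _
  rw [hgz]
  exact Set.mem_biUnion hiN ⟨hcross, h.le_im_of_crossing hy hvert hcross⟩

theorem nonconicalLimitSet_subset (N : ℕ) :
    (fun ξ : Circle => (ξ : ℂ)) '' nonconicalLimitSet h.group ⊆
      {1} ∪ cayley '' ({z | Reaches c r (markedPoints c r ∪ survivors c r N) z} ∩
        {z | 0 ≤ z.im}) := by
  rintro _ ⟨ξ, hξ, rfl⟩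
  by_cases h1 : (ξ : ℂ) = 1
  · exact Or.inl h1
  refine Or.inr ⟨cayleyInv ξ, ⟨?_, (im_cayleyInv_circle ξ).ge⟩, cayley_cayleyInv h1⟩
  obtain ⟨z, hz⟩ := hξ.1
  rcases reaches_or_exists_isItinerary (c := c) (r := r) (im_cayleyInv_circle ξ) with
    hr | hr | ⟨y, i, hy, hy0⟩
  · exact absurd (accPt_cayleyInv h1 hz) (h.not_accPt_of_reaches_exterior hr z)
  · exact hr.mono Set.subset_union_left
  · obtain ⟨x, hx⟩ : ∃ x : ℝ, cayleyInv ξ = x :=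
      ⟨(cayleyInv ξ).re, Complex.ext rfl (by simpa using im_cayleyInv_circle ξ)⟩
    have hlim := h.tendsto_of_mem_nonconicalLimitSet hy (hy0.trans hx)
      (by rw [← hx, cayley_cayleyInv h1]) hξ
    obtain ⟨m, hm⟩ := (hlim.eventually_ge_atTop N).exists_forall_of_atTop
    have : y m ∈ survivors c r N := ⟨_, _, hy.tail m, by simp, fun n => hm _ (by omega)⟩
    change Reaches _ _ _ _
    rw [← hy0]
    exact hy.reaches (Or.inr this)

theorem dimH_nonconicalLimitSet (hsum : ∀ s : ℝ, 0 < s → Summable fun i => r i ^ s) :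
    dimH (nonconicalLimitSet h.group) = 0 := by
  have hle : ∀ s : ℝ≥0, 0 < s → dimH (nonconicalLimitSet h.group) ≤ s := by
    intro s hs
    obtain ⟨N, hN⟩ := h.exists_dimH_survivors_le hs (hsum s hs)
    have hiso : Isometry (fun ξ : Circle => (ξ : ℂ)) := isometry_subtype_coe
    rw [← hiso.dimH_image]
    refine (dimH_mono (h.nonconicalLimitSet_subset N)).trans ?_
    rw [dimH_union, dimH_singleton]
    refine max_le zero_le ?_
    refine ((lipschitzOnWith_cayley.mono Set.inter_subset_right).dimH_image_le).trans ?_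
    refine (dimH_mono Set.inter_subset_left).trans ((h.dimH_reaches_le _).trans ?_)
    rw [dimH_union, dimH_countable countable_markedPoints]
    exact max_le zero_le hN
  refine le_antisymm (ENNReal.le_of_forall_pos_le_add fun ε hε _ => ?_) zero_le
  rw [zero_add]
  exact hle ε hε

end SeparatedCircles

end

/-! ### The given centers and radii -/

theorem semicircleCenter_succ_ge (n : ℕ) :
    semicircleCenter (n + 1) + 2 ≤ semicircleCenter (n + 2) := by
  have h1 : (1 : ℝ) ≤ 2 ^ ((n + 2) ^ 2 + 2) := one_le_pow₀ (by norm_num)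
  rw [semicircleCenter]
  linarith

theorem semicircleCenter_add_two_le {i j : ℕ} (hij : i < j) :
    semicircleCenter (i + 1) + 2 ≤ semicircleCenter (j + 1) := by
  induction j, hij using Nat.le_induction with
  | base => exact semicircleCenter_succ_ge i
  | succ j _ ih => linarith [semicircleCenter_succ_ge j]

theorem semicircleRadius_succ_le (i : ℕ) : semicircleRadius (i + 1) ≤ (1 / 4) ^ (i + 1) := by
  have h1 : semicircleRadius (i + 1) = (1 / 4) ^ ((i + 1) ^ 2) := by
    rw [semicircleRadius, pow_mul, ← inv_pow]
    norm_num
  rw [h1]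
  exact pow_le_pow_of_le_one (by norm_num) (by norm_num) (Nat.le_self_pow two_ne_zero _)

theorem semicircleRadius_pos (i : ℕ) : 0 < semicircleRadius i := by
  unfold semicircleRadius
  positivity

/-- Of the growth of the centers only gaps of at least 2 are needed. The shift by one skips the
unused index 0. -/
theorem separatedCircles_semicircles :
    SeparatedCircles (fun i => semicircleCenter (i + 1)) (fun i => semicircleRadius (i + 1)) where
  pos i := semicircleRadius_pos _
  le i := (semicircleRadius_succ_le i).trans
    (pow_le_of_le_one (by norm_num) (by norm_num) i.succ_ne_zero)
  sep i j hij := by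
    rcases lt_or_gt_of_ne hij with hlt | hlt
    · rw [abs_sub_comm]
      exact le_trans (by linarith [semicircleCenter_add_two_le hlt]) (le_abs_self _)
    · exact le_trans (by linarith [semicircleCenter_add_two_le hlt]) (le_abs_self _)

/-- The radii are dominated by a geometric sequence, so every positive power is summable; this is
what brings the dimension down to 0. -/
theorem summable_semicircleRadius_rpow {s : ℝ} (hs : 0 < s) :
    Summable fun i => semicircleRadius (i + 1) ^ s := by
  have hq : (1 / 4 : ℝ) ^ s < 1 := Real.rpow_lt_one (by norm_num) (by norm_num) hs
  have hgeom : Summable fun i : ℕ => ((1 / 4 : ℝ) ^ s) ^ (i + 1) :=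
    (summable_nat_add_iff 1).2 (summable_geometric_of_lt_one (by positivity) hq)
  refine hgeom.of_nonneg_of_le (fun i => Real.rpow_nonneg (semicircleRadius_pos _).le _)
    fun i => ?_
  rw [← Real.rpow_natCast, ← Real.rpow_mul (by norm_num), mul_comm, Real.rpow_mul (by norm_num),
    Real.rpow_natCast]
  exact Real.rpow_le_rpow (semicircleRadius_pos _).le (semicircleRadius_succ_le i) hs.le

theorem theorem1p3 :
    ∃ Γ : Subgroup (ℍ ≃ᵢ ℍ),
      DiscreteTopology Γ ∧
      ¬ Γ.FG ∧
      dimH (nonconicalLimitSet Γ) = 0 ∧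
      (∀ i j : ℕ, 1 ≤ i → 1 ≤ j → i ≠ j →
        Disjoint (Metric.closedBall (semicircleCenter i : ℂ) (semicircleRadius i))
          (Metric.closedBall (semicircleCenter j : ℂ) (semicircleRadius j))) ∧
      Γ = Subgroup.closure
        {h | ∃ i : ℕ, 1 ≤ i ∧
          h = inversionIsom (semicircleCenter i) (semicircleRadius i)
            (semicircleRadius_ne_zero i)} := by
  have h := separatedCircles_semicircles
  refine ⟨h.group, h.discreteTopology_group, h.not_fg_group,
    h.dimH_nonconicalLimitSet fun _ => summable_semicircleRadius_rpow, ?_, ?_⟩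
  · intro i j hi hj hij
    obtain ⟨i, rfl⟩ := Nat.exists_eq_add_of_le' hi
    obtain ⟨j, rfl⟩ := Nat.exists_eq_add_of_le' hj
    rw [Set.disjoint_left]
    intro z hzi hzj
    exact hij (congrArg (· + 1) (h.eq_of_dist_le hzi hzj))
  · rw [SeparatedCircles.group]
    congr 1
    ext g
    constructor
    · rintro ⟨i, rfl⟩
      exact ⟨i + 1, by omega, rfl⟩
    · rintro ⟨i, hi, rfl⟩
      obtain ⟨i, rfl⟩ := Nat.exists_eq_add_of_le' hi
      exact ⟨i, rfl⟩
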